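/- Let $k\ge 1$, let $n_1,\dots,n_k\ge 1$ be integers and let $\mathcal H$ be a complex Hilbert space. Let $F^2(H_{n_i})$ be the full Fock space of an $n_i$-dimensional complex Hilbert space $H_{n_i}$, with orthonormal basis $\{e^i_\alpha\}$ indexed by the words $\alpha$ in the unital free semigroup $\mathbb F_{n_i}^+$ on the generators $g^i_1,\dots,g^i_{n_i}$. Let $S_{i,j}e^i_\alpha=e^i_{g^i_j\alpha}$ be the left creation operators, and let ${\bf W}_{i,j}=I\otimes\cdots\otimes I\otimes S_{i,j}\otimes I\otimes\cdots\otimes I$ (with $S_{i,j}$ in the $i$-th position), acting on $\otimes_{i=1}^kF^2(H_{n_i})$; the tuple ${\bf W}=({\bf W}_{i,j})$, $1\le i\le k$, $1\le j\le n_i$, is the universal model of the noncommutative polyball. A bounded operator $\Phi:(\otimes_iF^2(H_{n_i}))\otimes\mathcal L\to(\otimes_iF^2(H_{n_i}))\otimes\mathcal H$ is called multi-analytic if $\Phi({\bf W}_{i,j}\otimes I_{\mathcal L})=({\bf W}_{i,j}\otimes I_{\mathcal H})\Phi$ for all $i,j$. A tuple $T=(T_{i,j})$ of bounded operators on a Hilbert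 space is called doubly commuting if, for all $i_1\ne i_2$ and all $j_1,j_2$, the operator $T_{i_1,j_1}$ commutes with both $T_{i_2,j_2}$ and $T_{i_2,j_2}^*$. (a) Let $\mathcal M\subset(\otimes_{i=1}^kF^2(H_{n_i}))\otimes\mathcal H$ be a nonzero closed subspace invariant under all the operators ${\bf W}_{i,j}\otimes I_{\mathcal H}$. Then the tuple of restrictions $({\bf W}_{i,j}\otimes I_{\mathcal H})|_{\mathcal M}$ is doubly commuting (adjoints being taken in $B(\mathcal M)$) if and only if there are a Hilbert space $\mathcal L$ and an isometric multi-analytic operator $\Phi:(\otimes_{i=1}^kF^2(H_{n_i}))\otimes\mathcal L\to(\otimes_{i=1}^kF^2(H_{n_i}))\otimes\mathcal H$ such that $\mathcal M=\Phi\big((\otimes_{i=1}^kF^2(H_{n_i}))\otimes\mathcal L\big)$. (b) (The case $n_1=\cdots=n_k=1$, on the polydisc.) Let $H^2(\mathbb D^k)$ be the Hardy space of the functions $f(z)=\sum_{\alpha\in\mathbb Z_+^k}c_\alpha z^\alpha$ on $\mathbb D^k$ with $\|f\|^2=\sum_\alpha|c_\alpha|^2<\infty$, and let $M_{z_i}$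 be multiplication by $z_i$ on it. Let $\mathcal M\subset H^2(\mathbb D^k)\otimes\mathcal H$ be a nonzero closed subspace invariant under $M_{z_1}\otimes I_{\mathcal H},\dots,M_{z_k}\otimes I_{\mathcal H}$. Then the tuple of restrictions $(M_{z_i}\otimes I_{\mathcal H})|_{\mathcal M}$, $1\le i\le k$, is doubly commuting if and only if there are a Hilbert space $\mathcal L$ and an isometry $\Phi:H^2(\mathbb D^k)\otimes\mathcal L\to H^2(\mathbb D^k)\otimes\mathcal H$ with $\Phi(M_{z_i}\otimes I_{\mathcal L})=(M_{z_i}\otimes I_{\mathcal H})\Phi$ for all $i$ and $\mathcal M=\Phi\big(H^2(\mathbb D^k)\otimes\mathcal L\big)$. -/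

import Mathlib

universe u

noncomputable section

open scoped TensorProduct

namespace Polyball

/-! ### Hilbert tensor products and ampliations -/

/-- The Hilbert space tensor product `E ⊗ H`: the completion of the algebraic tensor product
for the inner product `⟪a ⊗ h, b ⊗ g⟫ = ⟪a, b⟫ ⟪h, g⟫`. -/
abbrev HTensor (E : Type*) [NormedAddCommGroup E] [InnerProductSpace ℂ E]
    (H : Type*) [NormedAddCommGroup H] [InnerProductSpace ℂ H] : Type _ :=
  UniformSpace.Completion (E ⊗[ℂ] H)

/-- The operator `T ⊗ I_H` on the Hilbert tensor product `E ⊗ H`. -/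
def ampl {E : Type*} [NormedAddCommGroup E] [InnerProductSpace ℂ E] (T : E →L[ℂ] E)
    (H : Type*) [NormedAddCommGroup H] [InnerProductSpace ℂ H] :
    HTensor E H →L[ℂ] HTensor E H :=
  (ContinuousLinearMap.rTensor H T).completion

theorem ampl_tmul {E : Type*} [NormedAddCommGroup E] [InnerProductSpace ℂ E] (T : E →L[ℂ] E)
    {H : Type*} [NormedAddCommGroup H] [InnerProductSpace ℂ H] (x : E) (h : H) :
    ampl T H ((x ⊗ₜ[ℂ] h : E ⊗[ℂ] H) : HTensor E H) =
      ((T x ⊗ₜ[ℂ] h : E ⊗[ℂ] H) : HTensor E H) := by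
  rw [ampl, ContinuousLinearMap.completion_apply_coe]
  rfl

/-! ### Tuples of operators -/

section Tuples

variable {k : ℕ} {n : Fin k → ℕ}
variable {K : Type*} [NormedAddCommGroup K] [InnerProductSpace ℂ K]

/-- `M` is (jointly) invariant under the operators `T i j`. -/
def IsJointlyInvariant (T : ∀ i, Fin (n i) → K →L[ℂ] K) (M : Submodule ℂ K) : Prop :=
  ∀ i j, ∀ x ∈ M, T i j x ∈ M

/-- The restriction `T|_M` of a tuple of operators to an invariant subspace. -/
def restrictTuple (T : ∀ i, Fin (n i) → K →L[ℂ] K) (M : Submodule ℂ K) (hM : IsJointlyInvariant T M) :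
    ∀ i, Fin (n i) → M →L[ℂ] M :=
  fun i j => (T i j).restrict (hM i j)

/-- A `k`-tuple `T = (T_1, …, T_k)` of tuples of operators on a Hilbert space is doubly commuting
if for `i₁ ≠ i₂` every entry of `T_{i₁}` commutes with every entry of `T_{i₂}` and with the
adjoint of every entry of `T_{i₂}`. There is no condition on entries of the same `T_i`. -/
def DoublyCommuting (n : Fin k → ℕ) (K : Type*) [NormedAddCommGroup K] [InnerProductSpace ℂ K]
    [CompleteSpace K] (T : ∀ i, Fin (n i) → K →L[ℂ] K) : Prop :=
  ∀ i₁ i₂, i₁ ≠ i₂ → ∀ (j₁ : Fin (n i₁)) (j₂ : Fin (n i₂)),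
    T i₁ j₁ ∘L T i₂ j₂ = T i₂ j₂ ∘L T i₁ j₁ ∧
    T i₁ j₁ ∘L ContinuousLinearMap.adjoint (T i₂ j₂) =
      ContinuousLinearMap.adjoint (T i₂ j₂) ∘L T i₁ j₁

variable {E : Type*} [NormedAddCommGroup E] [InnerProductSpace ℂ E]

/-- The tuple `W ⊗ I_H = (W_{i,j} ⊗ I_H)`. -/
def amplTuple (W : ∀ i, Fin (n i) → E →L[ℂ] E)
    (H : Type*) [NormedAddCommGroup H] [InnerProductSpace ℂ H] :
    ∀ i, Fin (n i) → HTensor E H →L[ℂ] HTensor E H :=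
  fun i j => ampl (W i j) H

/-- `Φ : E ⊗ L → E ⊗ H` is multi-analytic with respect to the tuple `W` on `E`:
`Φ (W_{i,j} ⊗ I_L) = (W_{i,j} ⊗ I_H) Φ`. -/
def IsMultiAnalytic (W : ∀ i, Fin (n i) → E →L[ℂ] E)
    {L : Type*} [NormedAddCommGroup L] [InnerProductSpace ℂ L]
    {H : Type*} [NormedAddCommGroup H] [InnerProductSpace ℂ H]
    (Φ : HTensor E L →L[ℂ] HTensor E H) : Prop :=
  ∀ i j, Φ ∘L amplTuple W L i j = amplTuple W H i j ∘L Φ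

end Tuples

instance completeSpace_closedSubmodule {K : Type*} [NormedAddCommGroup K] [InnerProductSpace ℂ K]
    [CompleteSpace K] (M : ClosedSubmodule ℂ K) : CompleteSpace M.toSubmodule :=
  M.isClosed.completeSpace_coe

/-! ### The full Fock spaces and the universal model of the polyball -/

section Fock

variable {k : ℕ}

/-- `k`-tuples `β = (β_1, …, β_k)` of words, `β_i` in the free monoid on `n_i` generators. -/
abbrev Words (n : Fin k → ℕ) : Type := ∀ i, FreeMonoid (Fin (n i))

instance decidableEqWords (n : Fin k → ℕ) : DecidableEq (Words n) := Classical.decEq _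

/-- The Hilbert space `F²(H_{n_1}) ⊗ ⋯ ⊗ F²(H_{n_k})`, where `F²(H_m)` is the full Fock space of
an `m`-dimensional Hilbert space. It is given as `ℓ²` over its orthonormal basis
`e_β = e^1_{β_1} ⊗ ⋯ ⊗ e^k_{β_k}`, indexed by the tuples of words. -/
abbrev PolyFock (n : Fin k → ℕ) : Type := lp (fun _ : Words n => ℂ) 2

/-- The basis vector `e^1_{β_1} ⊗ ⋯ ⊗ e^k_{β_k}`. -/
def basisVec {n : Fin k → ℕ} (β : Words n) : PolyFock n := lp.single 2 β (1 : ℂ)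

/-- `β ↦ (β_1, …, g_j β_i, …, β_k)`. -/
def prepend {n : Fin k → ℕ} (i : Fin k) (j : Fin (n i)) (β : Words n) : Words n :=
  Function.update β i (FreeMonoid.of j * β i)

theorem prepend_injective {n : Fin k → ℕ} (i : Fin k) (j : Fin (n i)) :
    Function.Injective (prepend (n := n) i j) := by
  intro β γ h
  funext l
  have hl := congrFun h l
  by_cases hli : l = i
  · subst hli
    simpa [prepend] using hl
  · simpa [prepend, hli] using hl

theorem orthonormal_basisVec_prepend {n : Fin k → ℕ} (i : Fin k) (j : Fin (n i)) :
    Orthonormal ℂ (fun β : Words n => basisVec (prepend i j β)) := by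
  rw [orthonormal_iff_ite]
  intro β γ
  simp only [basisVec, lp.inner_single_left, lp.single_apply, Pi.single_apply,
    (prepend_injective i j).eq_iff]
  split_ifs <;> simp

/-- The universal model of the polyball: `W_{i,j} = I ⊗ ⋯ ⊗ S_j ⊗ ⋯ ⊗ I`, with the left creation
operator `S_j : e_α ↦ e_{g_j α}` of the `i`-th full Fock space in position `i`. -/
def universalModel (n : Fin k → ℕ) (i : Fin k) (j : Fin (n i)) : PolyFock n →L[ℂ] PolyFock n :=
  ((orthonormal_basisVec_prepend i j).orthogonalFamily.linearIsometry).toContinuousLinearMap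

theorem universalModel_basisVec (n : Fin k → ℕ) (i : Fin k) (j : Fin (n i)) (β : Words n) :
    universalModel n i j (basisVec β) = basisVec (prepend i j β) := by
  have h := (orthonormal_basisVec_prepend i j).orthogonalFamily.linearIsometry_apply_single
    (i := β) (1 : ℂ)
  exact h.trans (by simp)

end Fock

/-! ### The Hardy space of the polydisc -/

/-- The open unit polydisc `𝔻^k`. -/
abbrev Polydisc (k : ℕ) : Type := {z : Fin k → ℂ // ∀ i, ‖z i‖ < 1}

/-- `z^α = ∏ i, z_i ^ α_i`. -/
def monomial {k : ℕ} (z : Fin k → ℂ) (α : Fin k → ℕ) : ℂ := ∏ i, z i ^ α i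

theorem summable_norm_monomial : ∀ {k : ℕ} (z : Fin k → ℂ), (∀ i, ‖z i‖ < 1) →
    Summable (fun α : Fin k → ℕ => ‖monomial z α‖)
  | 0, _, _ => Summable.of_finite
  | k + 1, z, hz => by
    have h1 : Summable (fun m : ℕ => ‖z 0‖ ^ m) :=
      summable_geometric_of_lt_one (norm_nonneg _) (hz 0)
    have h2 := summable_norm_monomial (fun i : Fin k => z i.succ) (fun i => hz i.succ)
    have h3 := h1.mul_of_nonneg h2 (fun _ => by positivity) (fun _ => by positivity)
    rw [← (Fin.consEquiv (fun _ : Fin (k + 1) => ℕ)).summable_iff]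
    refine h3.congr fun p => ?_
    simp [monomial, Fin.prod_univ_succ, Fin.consEquiv]

theorem coeff_eq_zero_of_hasSum_pow (g : ℕ → ℂ)
    (h : ∀ w : ℂ, ‖w‖ < 1 → HasSum (fun m => w ^ m * g m) 0) (m : ℕ) : g m = 0 := by
  let p : FormalMultilinearSeries ℂ ℂ ℂ :=
    fun m => ContinuousMultilinearMap.mkPiRing ℂ (Fin m) (g m)
  have hc : ∀ m, p.coeff m = g m := fun m => by simp [p, FormalMultilinearSeries.coeff]
  have hp : HasFPowerSeriesAt (0 : ℂ → ℂ) p 0 := by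
    rw [hasFPowerSeriesAt_iff]
    filter_upwards [Metric.ball_mem_nhds (0 : ℂ) one_pos] with w hw
    simp only [hc, smul_eq_mul, Pi.zero_apply]
    exact h w (by simpa using hw)
  rw [← hc m, hp.eq_zero]
  simp [FormalMultilinearSeries.coeff]

theorem coeff_eq_zero_of_hasSum_monomial : ∀ {k : ℕ} (c : (Fin k → ℕ) → ℂ),
    (∀ z : Fin k → ℂ, (∀ i, ‖z i‖ < 1) → HasSum (fun α => c α * monomial z α) 0) → ∀ α, c α = 0
  | 0, c, h, α => by
    have h0 := h (fun _ => 0) (fun i => i.elim0)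
    have h2 := h0.unique (hasSum_unique (fun α => c α * monomial (fun _ => 0) α))
    simp only [monomial, Finset.univ_eq_empty, Finset.prod_empty, mul_one] at h2
    rw [h2]
    exact congrArg c (Subsingleton.elim _ _)
  | k + 1, c, h, α => by
    have key : ∀ z' : Fin k → ℂ, (∀ i, ‖z' i‖ < 1) → ∀ m : ℕ,
        HasSum (fun β : Fin k → ℕ => c (Fin.cons m β) * monomial z' β) 0 := by
      intro z' hz'
      have hs : ∀ w : ℂ, ‖w‖ < 1 → HasSum (fun p : ℕ × (Fin k → ℕ) =>
          w ^ p.1 * (c (Fin.cons p.1 p.2) * monomial z' p.2)) 0 := by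
        intro w hw
        have h0 := h (Fin.cons (α := fun _ => ℂ) w z') (Fin.cases hw hz')
        rw [← (Fin.consEquiv (fun _ : Fin (k + 1) => ℕ)).hasSum_iff] at h0
        refine (congrArg (fun F => HasSum F (0 : ℂ)) (funext fun p => ?_)).mpr h0
        have hp : (Fin.consEquiv fun _ : Fin (k + 1) => ℕ) p = Fin.cons p.1 p.2 := rfl
        simp only [Function.comp_apply, hp, monomial, Fin.prod_univ_succ,
          Fin.cons_zero, Fin.cons_succ]
        ring
      have hfib : ∀ m : ℕ, Summable (fun β : Fin k → ℕ => c (Fin.cons m β) * monomial z' β) := by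
        intro m
        have hhalf : ‖(1 / 2 : ℂ)‖ < 1 := by norm_num
        have hne : ((1 / 2 : ℂ)) ^ m ≠ 0 := pow_ne_zero m (by norm_num)
        have h1 : Summable (fun β : Fin k → ℕ =>
            (1 / 2 : ℂ) ^ m * (c (Fin.cons m β) * monomial z' β)) :=
          (hs (1 / 2) hhalf).summable.prod_factor m
        exact (summable_mul_left_iff hne).1 h1
      let g : ℕ → ℂ := fun m => ∑' β : Fin k → ℕ, c (Fin.cons m β) * monomial z' β
      have hone : ∀ w : ℂ, ‖w‖ < 1 → HasSum (fun m => w ^ m * g m) 0 := fun w hw =>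
        (hs w hw).prod_fiberwise fun m => (hfib m).hasSum.mul_left (w ^ m)
      intro m
      have hgm : g m = 0 := coeff_eq_zero_of_hasSum_pow g hone m
      exact hgm ▸ (hfib m).hasSum
    have h1 := coeff_eq_zero_of_hasSum_monomial (fun β => c (Fin.cons (α 0) β))
      (fun z' hz' => key z' hz' (α 0)) (Fin.tail α)
    simpa [Fin.cons_self_tail] using h1

/-- The functions `f` on `𝔻^k` of the form `f(z) = ∑_α c_α z^α` with `∑_α |c_α|² < ∞`. -/
def hardySubmodule (k : ℕ) : Submodule ℂ (Polydisc k → ℂ) where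
  carrier := {f | ∃ c : lp (fun _ : Fin k → ℕ => ℂ) 2,
    ∀ z, HasSum (fun α => c α * monomial z.1 α) (f z)}
  zero_mem' := ⟨0, fun z => by simp⟩
  add_mem' := by
    rintro f g ⟨c, hc⟩ ⟨d, hd⟩
    exact ⟨c + d, fun z => by simpa [add_mul] using (hc z).add (hd z)⟩
  smul_mem' := by
    rintro a f ⟨c, hc⟩
    exact ⟨a • c, fun z => by simpa [mul_assoc] using (hc z).mul_left a⟩

/-- The Hardy space `H²(𝔻^k)`. -/
def HardySpace (k : ℕ) : Type := hardySubmodule k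

namespace HardySpace

variable {k : ℕ}

instance : AddCommGroup (HardySpace k) := inferInstanceAs (AddCommGroup (hardySubmodule k))
instance : Module ℂ (HardySpace k) := inferInstanceAs (Module ℂ (hardySubmodule k))
instance : CoeFun (HardySpace k) (fun _ => Polydisc k → ℂ) := ⟨fun f => f.1⟩

theorem hasSum_series (c : lp (fun _ : Fin k → ℕ => ℂ) 2) (z : Polydisc k) :
    HasSum (fun α => c α * monomial z.1 α) (∑' α, c α * monomial z.1 α) := by
  refine Summable.hasSum (Summable.of_norm_bounded
    (g := fun α => ‖c‖ * ‖monomial z.1 α‖) ((summable_norm_monomial z.1 z.2).mul_left _) ?_)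
  intro α
  rw [norm_mul]
  gcongr
  exact lp.norm_apply_le_norm two_ne_zero c α

theorem coeff_unique {f : Polydisc k → ℂ} {c d : lp (fun _ : Fin k → ℕ => ℂ) 2}
    (hc : ∀ z, HasSum (fun α => c α * monomial z.1 α) (f z))
    (hd : ∀ z, HasSum (fun α => d α * monomial z.1 α) (f z)) : c = d := by
  have h := coeff_eq_zero_of_hasSum_monomial (fun α => c α - d α) (fun z hz => by
    simpa [sub_mul] using (hc ⟨z, hz⟩).sub (hd ⟨z, hz⟩))
  ext α
  exact sub_eq_zero.1 (h α)

/-- `f ↦` its sequence of Taylor coefficients, a bijection of `H²(𝔻^k)` onto `ℓ²(ℕ^k)`. -/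
def coeffEquiv : HardySpace k ≃ₗ[ℂ] lp (fun _ : Fin k → ℕ => ℂ) 2 :=
  LinearEquiv.symm
    { toFun := fun c => ⟨fun z => ∑' α, c α * monomial z.1 α, c, fun z => hasSum_series c z⟩
      map_add' := fun c d => Subtype.ext <| funext fun z => by
        have h := (hasSum_series c z).add (hasSum_series d z)
        refine HasSum.tsum_eq ?_
        simp only [lp.coeFn_add, Pi.add_apply, add_mul]
        exact h
      map_smul' := fun a c => Subtype.ext <| funext fun z => by
        have h := (hasSum_series c z).mul_left a
        refine HasSum.tsum_eq ?_
        simp only [lp.coeFn_smul, Pi.smul_apply, smul_eq_mul, mul_assoc]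
        exact h
      invFun := fun f => f.2.choose
      left_inv := fun c => coeff_unique (fun z => Exists.choose_spec
        (⟨c, fun z => hasSum_series c z⟩ : ∃ d : lp (fun _ : Fin k → ℕ => ℂ) 2, ∀ z : Polydisc k,
          HasSum (fun α => d α * monomial z.1 α) (∑' α, c α * monomial z.1 α)) z)
        (hasSum_series c)
      right_inv := fun f => Subtype.ext <| funext fun z => (f.2.choose_spec z).tsum_eq }

theorem hasSum_coeff (f : HardySpace k) (z : Polydisc k) :
    HasSum (fun α => coeffEquiv f α * monomial z.1 α) (f z) :=
  f.2.choose_spec z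

/-- The norm `‖f‖ = (∑_α |c_α|²)^{1/2}` in terms of the Taylor coefficients. -/
instance : NormedAddCommGroup (HardySpace k) :=
  NormedAddCommGroup.induced (HardySpace k) (lp (fun _ : Fin k → ℕ => ℂ) 2)
    (coeffEquiv (k := k)) coeffEquiv.injective

instance : InnerProductSpace ℂ (HardySpace k) where
  toNormedSpace := NormedSpace.induced ℂ (HardySpace k) (lp (fun _ : Fin k → ℕ => ℂ) 2)
    (coeffEquiv (k := k))
  inner f g := inner ℂ (coeffEquiv f) (coeffEquiv g)
  norm_sq_eq_re_inner f := norm_sq_eq_re_inner (𝕜 := ℂ) (coeffEquiv f)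
  conj_inner_symm f g := inner_conj_symm (coeffEquiv f) (coeffEquiv g)
  add_left f g h := by rw [map_add]; exact inner_add_left _ _ _
  smul_left f g a := by rw [map_smul]; exact inner_smul_left _ _ _

theorem norm_coeffEquiv (f : HardySpace k) : ‖coeffEquiv f‖ = ‖f‖ := rfl

instance : CompleteSpace (HardySpace k) :=
  let e : HardySpace k ≃ₗᵢ[ℂ] lp (fun _ : Fin k → ℕ => ℂ) 2 := ⟨coeffEquiv, norm_coeffEquiv⟩
  (completeSpace_congr (e := e.toEquiv) e.isometry.isUniformEmbedding).2 inferInstance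

/-- The exponent `α + ε_i`. -/
def raise (i : Fin k) (α : Fin k → ℕ) : Fin k → ℕ := Function.update α i (α i + 1)

theorem raise_injective (i : Fin k) : Function.Injective (raise i) := by
  intro α β h
  funext l
  have hl := congrFun h l
  by_cases hli : l = i
  · subst hli
    simpa [raise] using hl
  · simpa [raise, hli] using hl

theorem monomial_raise (z : Fin k → ℂ) (i : Fin k) (α : Fin k → ℕ) :
    monomial z (raise i α) = z i * monomial z α := by
  have h : ∏ l ∈ Finset.univ.erase i, z l ^ raise i α l = ∏ l ∈ Finset.univ.erase i, z l ^ α l :=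
    Finset.prod_congr rfl fun l hl => by simp [raise, Finset.ne_of_mem_erase hl]
  have h1 := Finset.mul_prod_erase Finset.univ (fun l => z l ^ raise i α l) (Finset.mem_univ i)
  have h2 := Finset.mul_prod_erase Finset.univ (fun l => z l ^ α l) (Finset.mem_univ i)
  rw [monomial, monomial, ← h1, ← h2]
  rw [h]
  simp [raise, pow_succ]
  ring

/-- The Taylor coefficients of `z_i f` in terms of those of `f`. -/
def shiftCoeff (i : Fin k) (c : lp (fun _ : Fin k → ℕ => ℂ) 2) :
    lp (fun _ : Fin k → ℕ => ℂ) 2 :=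
  ⟨Function.extend (raise i) c 0, by
    refine memℓp_gen ?_
    have h := (lp.memℓp c).summable (by norm_num)
    refine ((raise_injective i).summable_iff ?_).1 (h.congr fun α => ?_)
    · intro α hα
      rw [Function.extend_apply' _ _ _ (by simpa using hα)]
      simp
    · simp [(raise_injective i).extend_apply]⟩

theorem shiftCoeff_raise (i : Fin k) (c : lp (fun _ : Fin k → ℕ => ℂ) 2) (α : Fin k → ℕ) :
    shiftCoeff i c (raise i α) = c α :=
  (raise_injective i).extend_apply _ _ _

theorem shiftCoeff_of_notMem (i : Fin k) (c : lp (fun _ : Fin k → ℕ => ℂ) 2) {α : Fin k → ℕ}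
    (hα : α ∉ Set.range (raise i)) : shiftCoeff i c α = 0 :=
  Function.extend_apply' _ _ _ hα

theorem norm_shiftCoeff (i : Fin k) (c : lp (fun _ : Fin k → ℕ => ℂ) 2) :
    ‖shiftCoeff i c‖ = ‖c‖ := by
  rw [lp.norm_eq_tsum_rpow (by norm_num), lp.norm_eq_tsum_rpow (by norm_num)]
  congr 1
  rw [← (raise_injective i).tsum_eq]
  · exact tsum_congr fun α => by simp only [shiftCoeff_raise]
  · intro α hα
    by_contra hr
    refine hα ?_
    simp [shiftCoeff_of_notMem i c hr]

theorem hasSum_shiftCoeff (i : Fin k) (f : HardySpace k) (z : Polydisc k) :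
    HasSum (fun α => shiftCoeff i (coeffEquiv f) α * monomial z.1 α) (z.1 i * f z) := by
  refine ((raise_injective i).hasSum_iff ?_).1 ?_
  · intro α hα
    rw [shiftCoeff_of_notMem i _ hα, zero_mul]
  · refine (congrArg (fun F => HasSum F (z.1 i * f z)) (funext fun α => ?_)).mpr
      ((hasSum_coeff f z).mul_left (z.1 i))
    simp only [Function.comp_apply, shiftCoeff_raise, monomial_raise]
    ring

/-- Multiplication by the coordinate function `z_i` on `H²(𝔻^k)`. -/
def mulCoord (i : Fin k) : HardySpace k →L[ℂ] HardySpace k :=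
  LinearMap.mkContinuous
    { toFun := fun f => ⟨fun z => z.1 i * f z, shiftCoeff i (coeffEquiv f), hasSum_shiftCoeff i f⟩
      map_add' := fun f g => Subtype.ext <| funext fun z => mul_add _ _ _
      map_smul' := fun a f => Subtype.ext <| funext fun z => mul_left_comm _ _ _ }
    1 (fun f => by
      rw [one_mul, ← norm_coeffEquiv, ← norm_coeffEquiv f, ← norm_shiftCoeff i (coeffEquiv f)]
      exact le_of_eq (congrArg _ (coeff_unique (hasSum_coeff _) (hasSum_shiftCoeff i f))))

theorem mulCoord_apply (i : Fin k) (f : HardySpace k) (z : Polydisc k) :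
    mulCoord i f z = z.1 i * f z := rfl

end HardySpace

/-- The tuple `(M_{z_1}, …, M_{z_k})` on `H²(𝔻^k)`, as a `k`-tuple of `1`-tuples. -/
def coordTuple (k : ℕ) : ∀ _ : Fin k, Fin 1 → HardySpace k →L[ℂ] HardySpace k :=
  fun i _ => HardySpace.mulCoord i

end Polyball

end

open Polyball

/-!
An isometric multi-analytic operator `Φ` with range `M` is the same thing as a unitary operator of
`E ⊗ L` onto `M` that intertwines `W ⊗ I_L` with the restriction of `W ⊗ I_H` to `M`. Both parts
therefore follow from a Wold decomposition: a tuple is doubly commuting if and only if it is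
unitarily equivalent to some `W ⊗ I_L`, provided each of its rows consists of isometries with
orthogonal ranges and maps tuples of vectors of a nonzero subspace `X` never onto all of `X`. These
two conditions hold for `W ⊗ I_H` and pass to restrictions.

For such a tuple `V`, the space `L` is the joint kernel of the adjoints of the entries. The words
in `V` map `L` isometrically onto pairwise orthogonal subspaces, which `V` shifts as `W` shifts its
basis. Their sum reduces `V`, so its orthogonal complement does too. Double commutativity makes
the kernel of each adjoint row reduce the other rows, so these kernels can be intersected with the
complement one row at a time without ever reaching `0` unless the complement is `0`; but the last
intersection lies in `L` and in `Lᗮ`, so it is `0`.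
-/

noncomputable section

open ContinuousLinearMap
open scoped TensorProduct

namespace Polyball

section Words

variable {k : ℕ} {n : Fin k → ℕ}

theorem prepend_apply_self (i : Fin k) (j : Fin (n i)) (β : Words n) :
    prepend i j β i = FreeMonoid.of j * β i :=
  Function.update_self ..

theorem prepend_apply_of_ne {i l : Fin k} (h : l ≠ i) (j : Fin (n i)) (β : Words n) :
    prepend i j β l = β l :=
  Function.update_of_ne h ..

theorem prepend_eq_mulSingle_mul (i : Fin k) (j : Fin (n i)) (β : Words n) :
    prepend i j β = Pi.mulSingle i (FreeMonoid.of j) * β := by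
  funext l
  obtain rfl | h := eq_or_ne l i
  · simp [prepend_apply_self]
  · simp [prepend_apply_of_ne h, h]

theorem prepend_comm {i₁ i₂ : Fin k} (h : i₁ ≠ i₂) (j₁ : Fin (n i₁)) (j₂ : Fin (n i₂))
    (β : Words n) : prepend i₁ j₁ (prepend i₂ j₂ β) = prepend i₂ j₂ (prepend i₁ j₁ β) := by
  simp only [prepend_eq_mulSingle_mul, ← mul_assoc]
  exact congrArg (· * β) (Pi.mulSingle_commute (f := fun i => FreeMonoid (Fin (n i))) h _ _).eq

theorem prepend_ne_prepend {i : Fin k} {j j' : Fin (n i)} (h : j ≠ j') (β γ : Words n) :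
    prepend i j β ≠ prepend i j' γ := fun hβγ => by
  have hi := congrArg FreeMonoid.toList (congrFun hβγ i)
  simp only [prepend_apply_self, FreeMonoid.toList_of_mul, List.cons.injEq] at hi
  exact h hi.1

theorem prepend_ne_of_apply_eq_one {i : Fin k} {γ : Words n} (hγ : γ i = 1) (j : Fin (n i))
    (β : Words n) : prepend i j β ≠ γ := fun hβγ => by
  have hi := congrArg FreeMonoid.length (congrFun hβγ i)
  simp [prepend_apply_self, hγ] at hi

theorem apply_eq_one_or_exists_eq_prepend (i : Fin k) (β : Words n) :
    β i = 1 ∨ ∃ j γ, β = prepend i j γ := by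
  cases hβ : β i using FreeMonoid.casesOn with
  | one => exact .inl rfl
  | of_mul j w => exact .inr ⟨j, Function.update β i w, by simp [prepend, ← hβ]⟩

theorem prepend_induction_at {P : Words n → Prop} (i : Fin k) (one : ∀ β, β i = 1 → P β)
    (step : ∀ j β, P β → P (prepend i j β)) (β : Words n) : P β := by
  induction hw : β i using FreeMonoid.inductionOn' generalizing β with
  | one => exact one β hw
  | of_mul j w ih =>
    have hβ : β = prepend i j (Function.update β i w) := by simp [prepend, ← hw]
    rw [hβ]
    exact step j _ (ih _ (Function.update_self ..))

theorem prepend_induction {P : Words n → Prop} (one : P 1)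
    (step : ∀ i j β, P β → P (prepend i j β)) (β : Words n) : P β := by
  suffices h : ∀ (S : Finset (Fin k)) (β : Words n), (∀ i ∉ S, β i = 1) → P β from
    h Finset.univ β (by simp)
  intro S
  induction S using Finset.induction_on with
  | empty => exact fun β hβ => (funext fun i => hβ i (Finset.notMem_empty i) : β = 1) ▸ one
  | insert i S _ ih =>
    intro β
    induction β using prepend_induction_at i with
    | one β hi =>
      refine fun hβ => ih β fun l hl => ?_
      obtain rfl | hli := eq_or_ne l i
      · exact hi
      · exact hβ l (by simp [hl, hli])
    | step j β ihβ =>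
      refine fun hβ => step i j β (ihβ fun l hl => ?_)
      rw [← prepend_apply_of_ne (ne_of_mem_of_not_mem (Finset.mem_insert_self i S) hl).symm j β]
      exact hβ l hl

theorem exists_eq_prepend_of_ne_one {β : Words n} (hβ : β ≠ 1) : ∃ i j γ, β = prepend i j γ := by
  obtain ⟨i, hi⟩ := Function.ne_iff.1 hβ
  exact ⟨i, (apply_eq_one_or_exists_eq_prepend i β).resolve_left hi⟩

end Words

section WordProd

theorem commute_freeMonoid_lift_right {A α : Type*} [Monoid A] {a : A} {f : α → A}
    (h : ∀ x, Commute a (f x)) (w : FreeMonoid α) : Commute a (FreeMonoid.lift f w) := by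
  induction w using FreeMonoid.inductionOn' with
  | one => simp
  | of_mul x w ih => simpa using (h x).mul_right ih

theorem commute_freeMonoid_lift {A α α' : Type*} [Monoid A] {f : α → A} {g : α' → A}
    (h : ∀ x y, Commute (f x) (g y)) (w : FreeMonoid α) (w' : FreeMonoid α') :
    Commute (FreeMonoid.lift f w) (FreeMonoid.lift g w') :=
  (commute_freeMonoid_lift_right
    (fun x => (commute_freeMonoid_lift_right (h x) w').symm) w).symm

variable {k : ℕ} {n : Fin k → ℕ} {A : Type*} [Monoid A] {v : ∀ i, Fin (n i) → A}

/-- The product `v_β = v_{1,β_1} ⋯ v_{k,β_k}` of elements of a monoid, for tuples `v_1, …, v_k`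
that commute with each other, as a function of the words `β_1, …, β_k`. -/
def wordProd (hv : Pairwise fun i₁ i₂ => ∀ j₁ j₂, Commute (v i₁ j₁) (v i₂ j₂)) : Words n →* A :=
  MonoidHom.noncommPiCoprod (fun i => FreeMonoid.lift (v i)) <|
    hv.mono fun _ _ h => commute_freeMonoid_lift h

theorem wordProd_prepend (hv : Pairwise fun i₁ i₂ => ∀ j₁ j₂, Commute (v i₁ j₁) (v i₂ j₂))
    (i : Fin k) (j : Fin (n i)) (β : Words n) :
    wordProd hv (prepend i j β) = v i j * wordProd hv β := by
  rw [prepend_eq_mulSingle_mul, map_mul, wordProd, MonoidHom.noncommPiCoprod_mulSingle,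
    FreeMonoid.lift_eval_of]

theorem commute_wordProd_of_apply_eq_one
    (hv : Pairwise fun i₁ i₂ => ∀ j₁ j₂, Commute (v i₁ j₁) (v i₂ j₂)) {a : A} {i : Fin k}
    (ha : ∀ i', i' ≠ i → ∀ j', Commute a (v i' j')) {β : Words n} (hβ : β i = 1) :
    Commute a (wordProd hv β) := by
  induction β using prepend_induction with
  | one => simp
  | step i' j' β ih =>
    have hi : i' ≠ i := by
      rintro rfl
      exact prepend_ne_of_apply_eq_one hβ j' β rfl
    rw [prepend_apply_of_ne hi.symm] at hβ
    rw [wordProd_prepend]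
    exact (ha i' hi j').mul_right (ih hβ)

end WordProd

section DoublyCommuting

variable {k : ℕ} {n : Fin k → ℕ}
variable {K : Type*} [NormedAddCommGroup K] [InnerProductSpace ℂ K]
variable {K' : Type*} [NormedAddCommGroup K'] [InnerProductSpace ℂ K']

/-- Unitary equivalence of two tuples of operators: a single unitary operator intertwines
`T i j` with `T' i j` for all `i`, `j`. -/
def UnitarilyEquivalent (T : ∀ i, Fin (n i) → K →L[ℂ] K) (T' : ∀ i, Fin (n i) → K' →L[ℂ] K') :
    Prop :=
  ∃ U : K ≃ₗᵢ[ℂ] K', ∀ i j x, U (T i j x) = T' i j (U x)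

variable [CompleteSpace K] {T : ∀ i, Fin (n i) → K →L[ℂ] K}

theorem DoublyCommuting.commute (hT : DoublyCommuting n K T) :
    Pairwise fun i₁ i₂ => ∀ j₁ j₂, Commute (T i₁ j₁) (T i₂ j₂) :=
  fun i₁ i₂ h j₁ j₂ => (hT i₁ i₂ h j₁ j₂).1

theorem DoublyCommuting.commute_adjoint (hT : DoublyCommuting n K T) :
    Pairwise fun i₁ i₂ => ∀ j₁ j₂, Commute (adjoint (T i₁ j₁)) (T i₂ j₂) :=
  fun i₁ i₂ h j₁ j₂ => (hT i₂ i₁ h.symm j₂ j₁).2.symm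

theorem DoublyCommuting.adjoint_commute_adjoint (hT : DoublyCommuting n K T) :
    Pairwise fun i₁ i₂ => ∀ j₁ j₂, Commute (adjoint (T i₁ j₁)) (adjoint (T i₂ j₂)) :=
  fun _ _ h j₁ j₂ => (hT.commute h j₁ j₂).star_star

theorem DoublyCommuting.of_unitarilyEquivalent [CompleteSpace K']
    {T' : ∀ i, Fin (n i) → K' →L[ℂ] K'} (hT : DoublyCommuting n K T)
    (h : UnitarilyEquivalent T T') : DoublyCommuting n K' T' := by
  obtain ⟨U, hU⟩ := h
  obtain rfl : T' = fun i j => U.conjStarAlgEquiv (T i j) := by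
    funext i j
    ext x
    simp [hU]
  intro i₁ i₂ hi j₁ j₂
  simp only [← mul_def, ← star_eq_adjoint, ← map_star]
  simp only [← map_mul]
  exact ⟨congrArg _ (hT i₁ i₂ hi j₁ j₂).1, congrArg _ (hT i₁ i₂ hi j₁ j₂).2⟩

end DoublyCommuting

section RowIsometric

variable {k : ℕ} {n : Fin k → ℕ}
variable {K : Type*} [NormedAddCommGroup K] [InnerProductSpace ℂ K]
variable {T : ∀ i, Fin (n i) → K →L[ℂ] K}

/-- Each row `(T_{i,1}, …, T_{i,n_i})` consists of isometries with orthogonal ranges. -/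
def IsRowIsometric (T : ∀ i, Fin (n i) → K →L[ℂ] K) : Prop :=
  ∀ i j j' x y, inner ℂ (T i j x) (T i j' y) = if j = j' then inner ℂ x y else 0

/-- No row `(T_{i,1}, …, T_{i,n_i})` maps tuples of vectors of a nonzero subspace `X` onto a space
that contains `X`. This takes the place of the condition that the powers of the adjoints of each
row tend strongly to `0`; unlike the latter, it visibly passes to restrictions. -/
def IsPure (T : ∀ i, Fin (n i) → K →L[ℂ] K) : Prop :=
  ∀ i, ∀ X : Submodule ℂ K, X ≤ ⨆ j, X.map (T i j : K →ₗ[ℂ] K) → X = ⊥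

theorem IsRowIsometric.restrict (hT : IsRowIsometric T) {M : Submodule ℂ K}
    (hM : IsJointlyInvariant T M) : IsRowIsometric (restrictTuple T M hM) :=
  fun i j j' x y => hT i j j' x y

theorem IsPure.restrict (hT : IsPure T) {M : Submodule ℂ K} (hM : IsJointlyInvariant T M) :
    IsPure (restrictTuple T M hM) := by
  intro i X hX
  have hsubtype (j : Fin (n i)) : (X.map (restrictTuple T M hM i j : M →ₗ[ℂ] M)).map M.subtype =
      (X.map M.subtype).map (T i j : K →ₗ[ℂ] K) := by
    rw [← Submodule.map_comp, ← Submodule.map_comp]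
    rfl
  have hXT := Submodule.map_mono (f := M.subtype) hX
  simp only [Submodule.map_iSup, hsubtype] at hXT
  exact Submodule.map_injective_of_injective M.subtype_injective
    ((hT i _ hXT).trans (Submodule.map_bot _).symm)

theorem IsRowIsometric.norm_map (hT : IsRowIsometric T) (i : Fin k) (j : Fin (n i)) (x : K) :
    ‖T i j x‖ = ‖x‖ :=
  (LinearMap.norm_map_iff_inner_map_map (T i j)).2 (fun x y => by simp [hT i j j]) x

theorem IsRowIsometric.adjoint_apply [CompleteSpace K] (hT : IsRowIsometric T) (i : Fin k)
    (j j' : Fin (n i)) (x : K) : adjoint (T i j) (T i j' x) = if j = j' then x else 0 := by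
  refine ext_inner_left ℂ fun y => ?_
  rw [adjoint_inner_right, hT]
  split_ifs <;> simp

end RowIsometric

theorem clm_ext_of_dense_iSup {𝕜 E F ι : Type*} [Semiring 𝕜]
    [TopologicalSpace E] [AddCommMonoid E] [Module 𝕜 E] [ContinuousAdd E] [ContinuousConstSMul 𝕜 E]
    [TopologicalSpace F] [AddCommMonoid F] [Module 𝕜 F] [T2Space F]
    {p : ι → Submodule 𝕜 E} (hp : (⨆ i, p i).topologicalClosure = ⊤) {A B : E →L[𝕜] F}
    (h : ∀ i, ∀ x ∈ p i, A x = B x) : A = B := by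
  have hle : ⨆ i, p i ≤ LinearMap.eqLocus (A : E →ₗ[𝕜] F) B := iSup_le h
  refine ContinuousLinearMap.ext_on (s := (⨆ i, p i : Submodule 𝕜 E)) ?_ fun x hx => hle hx
  rwa [Submodule.span_eq, Submodule.dense_iff_topologicalClosure_eq_top]

theorem exists_linearIsometryEquiv_of_isHilbertSum {𝕜 ι E F : Type*} [RCLike 𝕜]
    [NormedAddCommGroup E] [InnerProductSpace 𝕜 E] [CompleteSpace E]
    [NormedAddCommGroup F] [InnerProductSpace 𝕜 F] [CompleteSpace F]
    {G : ι → Type*} [∀ i, NormedAddCommGroup (G i)] [∀ i, InnerProductSpace 𝕜 (G i)]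
    {V : ∀ i, G i →ₗᵢ[𝕜] E} {W : ∀ i, G i →ₗᵢ[𝕜] F}
    (hV : IsHilbertSum 𝕜 G V) (hW : IsHilbertSum 𝕜 G W) :
    ∃ U : E ≃ₗᵢ[𝕜] F, ∀ i x, U (V i x) = W i x := by
  classical
  refine ⟨hV.linearIsometryEquiv.trans hW.linearIsometryEquiv.symm, fun i x => ?_⟩
  rw [← hV.linearIsometryEquiv_symm_apply_single, ← hW.linearIsometryEquiv_symm_apply_single,
    LinearIsometryEquiv.trans_apply, LinearIsometryEquiv.apply_symm_apply]

section ShiftModel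

variable {k : ℕ} {n : Fin k → ℕ}
variable {K : Type*} [NormedAddCommGroup K] [InnerProductSpace ℂ K]
variable {L : Type*} [NormedAddCommGroup L] [InnerProductSpace ℂ L]

/-- `K` is the closed orthogonal sum of copies `ι β L` of `L`, which the operators `T i j` shift
in the way that `W_{i,j}` shifts the basis vectors of the Fock space. Mathlib's `IsHilbertSum` is
not used, because it makes the copies closed in `K` and so `L` complete. -/
structure IsShiftModel (T : ∀ i, Fin (n i) → K →L[ℂ] K) (ι : Words n → L →ₗᵢ[ℂ] K) : Prop where
  orthogonal : OrthogonalFamily ℂ (fun _ : Words n => L) ι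
  dense : (⨆ β, LinearMap.range (ι β).toLinearMap).topologicalClosure = ⊤
  shift : ∀ i j β l, T i j (ι β l) = ι (prepend i j β) l

namespace IsShiftModel

variable {T : ∀ i, Fin (n i) → K →L[ℂ] K} {ι : Words n → L →ₗᵢ[ℂ] K}

theorem clm_ext (hT : IsShiftModel T ι) {K' : Type*} [NormedAddCommGroup K']
    [NormedSpace ℂ K'] {A B : K →L[ℂ] K'} (h : ∀ β l, A (ι β l) = B (ι β l)) : A = B :=
  clm_ext_of_dense_iSup hT.dense fun β _ ⟨l, hl⟩ => hl ▸ h β l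

theorem ext_inner (hT : IsShiftModel T ι) {x y : K}
    (h : ∀ β l, inner ℂ x (ι β l) = inner ℂ y (ι β l)) : x = y :=
  innerSL_inj.1 (hT.clm_ext (A := innerSL ℂ x) (B := innerSL ℂ y) h)

theorem unitarilyEquivalent [CompleteSpace K] [CompleteSpace L] (hT : IsShiftModel T ι)
    {K' : Type*} [NormedAddCommGroup K'] [InnerProductSpace ℂ K'] [CompleteSpace K']
    {T' : ∀ i, Fin (n i) → K' →L[ℂ] K'} {ι' : Words n → L →ₗᵢ[ℂ] K'} (hT' : IsShiftModel T' ι') :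
    UnitarilyEquivalent T T' := by
  obtain ⟨U, hU⟩ := exists_linearIsometryEquiv_of_isHilbertSum
    (IsHilbertSum.mk hT.orthogonal hT.dense.ge) (IsHilbertSum.mk hT'.orthogonal hT'.dense.ge)
  have hUT (i : Fin k) (j : Fin (n i)) : (U : K →L[ℂ] K') ∘L T i j = T' i j ∘L (U : K →L[ℂ] K') :=
    hT.clm_ext fun β l => by simp [hT.shift, hT'.shift, hU]
  exact ⟨U, fun i j => DFunLike.congr_fun (hUT i j)⟩

variable [CompleteSpace K]

theorem adjoint_apply_of_forall_ne (hT : IsShiftModel T ι) {i : Fin k} {j : Fin (n i)}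
    {β : Words n} (hβ : ∀ γ, prepend i j γ ≠ β) (l : L) : adjoint (T i j) (ι β l) = 0 :=
  hT.ext_inner fun γ l' => by
    rw [adjoint_inner_left, hT.shift, hT.orthogonal (hβ γ).symm, inner_zero_left]

theorem adjoint_apply_of_apply_eq_one (hT : IsShiftModel T ι) {i : Fin k} {β : Words n}
    (hβ : β i = 1) (j : Fin (n i)) (l : L) : adjoint (T i j) (ι β l) = 0 :=
  hT.adjoint_apply_of_forall_ne (prepend_ne_of_apply_eq_one hβ j) l

theorem adjoint_apply_prepend (hT : IsShiftModel T ι) (i : Fin k) (j j' : Fin (n i)) (β : Words n)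
    (l : L) : adjoint (T i j) (ι (prepend i j' β) l) = if j = j' then ι β l else 0 := by
  split_ifs with hj
  · subst hj
    refine hT.ext_inner fun γ l' => ?_
    rw [adjoint_inner_left, hT.shift]
    obtain rfl | hβγ := eq_or_ne β γ
    · simp only [LinearIsometry.inner_map_map]
    · rw [hT.orthogonal hβγ, hT.orthogonal ((prepend_injective i j).ne hβγ)]
  · exact hT.adjoint_apply_of_forall_ne (fun γ => prepend_ne_prepend hj γ β) l

theorem isRowIsometric (hT : IsShiftModel T ι) : IsRowIsometric T := by
  intro i j j' x y
  have hadjoint : adjoint (T i j) ∘L T i j' = if j = j' then .id ℂ K else 0 :=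
    hT.clm_ext fun β l => by
      rw [comp_apply, hT.shift, hT.adjoint_apply_prepend]
      split_ifs <;> simp
  rw [← adjoint_inner_right, ← comp_apply, hadjoint]
  split_ifs <;> simp

theorem isPure (hT : IsShiftModel T ι) : IsPure T := by
  intro i X hX
  have inner_eq_zero_of_adjoint {y : K} (h : ∀ j, ∀ x ∈ X, inner ℂ x (adjoint (T i j) y) = 0) :
      ∀ x ∈ X, inner ℂ x y = 0 := by
    have hle : ⨆ j, X.map (T i j : K →ₗ[ℂ] K) ≤ (ℂ ∙ y)ᗮ :=
      iSup_le fun j => Submodule.map_le_iff_le_comap.2 fun x hx =>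
        Submodule.mem_orthogonal_singleton_iff_inner_left.2 <| by
          rw [← h j x hx, adjoint_inner_right, coe_coe]
    exact fun x hx => Submodule.mem_orthogonal_singleton_iff_inner_left.1 (hle (hX hx))
  have inner_eq_zero (β : Words n) (l : L) : ∀ x ∈ X, inner ℂ x (ι β l) = 0 := by
    induction β using prepend_induction_at i with
    | one β hβ =>
      refine inner_eq_zero_of_adjoint fun j x _ => ?_
      rw [hT.adjoint_apply_of_apply_eq_one hβ, inner_zero_right]
    | step j' β ih =>
      refine inner_eq_zero_of_adjoint fun j x hx => ?_
      rw [hT.adjoint_apply_prepend]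
      split_ifs
      · exact ih x hx
      · exact inner_zero_right x
  refine (Submodule.eq_bot_iff X).2 fun x hx => hT.ext_inner fun β l => ?_
  rw [inner_eq_zero β l x hx, inner_zero_left]

theorem doublyCommuting (hT : IsShiftModel T ι) : DoublyCommuting n K T := by
  refine fun i₁ i₂ hi j₁ j₂ => ⟨hT.clm_ext fun β l => ?_, hT.clm_ext fun β l => ?_⟩
  · simp only [comp_apply, hT.shift, prepend_comm hi]
  · simp only [comp_apply, hT.shift]
    obtain hβ | ⟨j, γ, rfl⟩ := apply_eq_one_or_exists_eq_prepend i₂ β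
    · rw [hT.adjoint_apply_of_apply_eq_one hβ, hT.adjoint_apply_of_apply_eq_one, map_zero]
      rwa [prepend_apply_of_ne hi.symm]
    · rw [prepend_comm hi, hT.adjoint_apply_prepend, hT.adjoint_apply_prepend]
      split_ifs
      · exact hT.shift i₁ j₁ γ l
      · exact map_zero _

end IsShiftModel

end ShiftModel

section Reducing

variable {𝕜 K : Type*} [RCLike 𝕜] [NormedAddCommGroup K] [InnerProductSpace 𝕜 K] [CompleteSpace K]

/-- The subspace `X`, which need not be closed, reduces the operator `A`: it is invariant under
`A` and under the adjoint of `A`. -/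
def IsReducing (A : K →L[𝕜] K) (X : Submodule 𝕜 K) : Prop :=
  X ∈ Module.End.invtSubmodule (A : K →ₗ[𝕜] K) ∧
    X ∈ Module.End.invtSubmodule (adjoint A : K →ₗ[𝕜] K)

variable {A : K →L[𝕜] K} {X Y : Submodule 𝕜 K}

theorem IsReducing.inf (hX : IsReducing A X) (hY : IsReducing A Y) : IsReducing A (X ⊓ Y) :=
  ⟨Module.End.invtSubmodule.inf_mem hX.1 hY.1, Module.End.invtSubmodule.inf_mem hX.2 hY.2⟩

theorem IsReducing.orthogonal (hX : IsReducing A X) : IsReducing A Xᗮ :=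
  ⟨orthogonal_mem_invtSubmodule hX.2,
    orthogonal_mem_invtSubmodule (by rw [adjoint_adjoint]; exact hX.1)⟩

end Reducing

section Wold

variable {k : ℕ} {n : Fin k → ℕ}
variable {K : Type*} [NormedAddCommGroup K] [InnerProductSpace ℂ K] [CompleteSpace K]

/-- The joint kernel of the adjoints of the entries of the `i`-th row of `V`. -/
def rowKernel (V : ∀ i, Fin (n i) → K →L[ℂ] K) (i : Fin k) : Submodule ℂ K :=
  ⨅ j, LinearMap.ker (adjoint (V i j) : K →ₗ[ℂ] K)

/-- The joint kernel of the adjoints of all entries of `V`, that is, the orthogonal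
complement of the ranges of all entries. -/
def wanderingSubspace (V : ∀ i, Fin (n i) → K →L[ℂ] K) : Submodule ℂ K :=
  ⨅ i, rowKernel V i

variable {V : ∀ i, Fin (n i) → K →L[ℂ] K}

theorem mem_rowKernel {i : Fin k} {x : K} :
    x ∈ rowKernel V i ↔ ∀ j, adjoint (V i j) x = 0 := by
  simp [rowKernel]

theorem mem_wanderingSubspace {x : K} :
    x ∈ wanderingSubspace V ↔ ∀ i j, adjoint (V i j) x = 0 := by
  simp [wanderingSubspace, mem_rowKernel]

theorem isClosed_wanderingSubspace : IsClosed (wanderingSubspace V : Set K) := by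
  simp only [wanderingSubspace, rowKernel, Submodule.coe_iInf]
  exact isClosed_iInter fun i => isClosed_iInter fun j => (adjoint (V i j)).isClosed_ker

theorem DoublyCommuting.isReducing_rowKernel (hV : DoublyCommuting n K V) {i i' : Fin k}
    (hi : i' ≠ i) (j' : Fin (n i')) : IsReducing (V i' j') (rowKernel V i) := by
  constructor <;> refine fun x hx => mem_rowKernel.2 fun j => ?_
  · have hcomm := DFunLike.congr_fun (hV.commute_adjoint hi.symm j j').eq x
    exact hcomm.trans (by simp [mem_rowKernel.1 hx])
  · have hcomm := DFunLike.congr_fun (hV.adjoint_commute_adjoint hi.symm j j').eq x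
    exact hcomm.trans (by simp [mem_rowKernel.1 hx])

theorem eq_bot_of_inf_rowKernel_eq_bot (hr : IsRowIsometric V) (hp : IsPure V) {i : Fin k}
    {X : Submodule ℂ K} (hX : ∀ j, IsReducing (V i j) X) (hbot : X ⊓ rowKernel V i = ⊥) :
    X = ⊥ := by
  refine hp i X fun x hx => ?_
  have hadj (j : Fin (n i)) : adjoint (V i j) x ∈ X := (hX j).2 hx
  have hker : x - ∑ j, V i j (adjoint (V i j) x) ∈ X ⊓ rowKernel V i := by
    refine ⟨X.sub_mem hx (X.sum_mem fun j _ => (hX j).1 (hadj j)), mem_rowKernel.2 fun j => ?_⟩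
    simp [hr.adjoint_apply]
  rw [hbot, Submodule.mem_bot, sub_eq_zero] at hker
  rw [hker]
  exact Submodule.sum_mem _ fun j _ => Submodule.mem_iSup_of_mem j ⟨_, hadj j, rfl⟩

theorem eq_bot_of_inf_iInf_rowKernel_eq_bot (hV : DoublyCommuting n K V) (hr : IsRowIsometric V)
    (hp : IsPure V) (S : Finset (Fin k)) {X : Submodule ℂ K}
    (hX : ∀ i ∈ S, ∀ j, IsReducing (V i j) X) (hbot : X ⊓ ⨅ i ∈ S, rowKernel V i = ⊥) :
    X = ⊥ := by
  induction S using Finset.induction_on generalizing X with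
  | empty => simpa using hbot
  | insert i S hi ih =>
    rw [Finset.iInf_insert, ← inf_assoc] at hbot
    refine eq_bot_of_inf_rowKernel_eq_bot hr hp (hX i (Finset.mem_insert_self i S)) (ih ?_ hbot)
    exact fun i' hi' j' => (hX i' (Finset.mem_insert_of_mem hi') j').inf
      (hV.isReducing_rowKernel (ne_of_mem_of_not_mem hi' hi) j')

theorem eq_bot_of_inf_wanderingSubspace_eq_bot (hV : DoublyCommuting n K V)
    (hr : IsRowIsometric V) (hp : IsPure V) {X : Submodule ℂ K}
    (hX : ∀ i j, IsReducing (V i j) X) (hbot : X ⊓ wanderingSubspace V = ⊥) : X = ⊥ :=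
  eq_bot_of_inf_iInf_rowKernel_eq_bot hV hr hp Finset.univ (fun i _ => hX i)
    (by simpa [wanderingSubspace] using hbot)

theorem norm_wordProd (hV : DoublyCommuting n K V) (hr : IsRowIsometric V) (β : Words n) (x : K) :
    ‖wordProd hV.commute β x‖ = ‖x‖ := by
  induction β using prepend_induction with
  | one => simp
  | step i j β ih => rw [wordProd_prepend, mul_apply_eq_comp, hr.norm_map, ih]

theorem adjoint_wordProd_of_apply_eq_one (hV : DoublyCommuting n K V) {i : Fin k} {β : Words n}
    (hβ : β i = 1) (j : Fin (n i)) {l : K} (hl : l ∈ wanderingSubspace V) :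
    adjoint (V i j) (wordProd hV.commute β l) = 0 := by
  have hcomm : Commute (adjoint (V i j)) (wordProd hV.commute β) :=
    commute_wordProd_of_apply_eq_one hV.commute (fun i' hi' => hV.commute_adjoint hi'.symm j) hβ
  exact (DFunLike.congr_fun hcomm.eq l).trans (by simp [mem_wanderingSubspace.1 hl])

theorem adjoint_wordProd_prepend (hV : DoublyCommuting n K V) (hr : IsRowIsometric V) (i : Fin k)
    (j j' : Fin (n i)) (β : Words n) (x : K) :
    adjoint (V i j) (wordProd hV.commute (prepend i j' β) x) =
      if j = j' then wordProd hV.commute β x else 0 := by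
  rw [wordProd_prepend, mul_apply_eq_comp, hr.adjoint_apply]

theorem inner_wordProd_of_ne (hV : DoublyCommuting n K V) (hr : IsRowIsometric V) {β γ : Words n}
    (h : β ≠ γ) {l l' : K} (hl : l ∈ wanderingSubspace V) (hl' : l' ∈ wanderingSubspace V) :
    inner ℂ (wordProd hV.commute β l) (wordProd hV.commute γ l') = 0 := by
  induction β using prepend_induction generalizing γ with
  | one =>
    obtain ⟨i, j, γ, rfl⟩ := exists_eq_prepend_of_ne_one h.symm
    rw [wordProd_prepend, mul_apply_eq_comp, ← adjoint_inner_left, map_one, one_apply_eq_self,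
      mem_wanderingSubspace.1 hl, inner_zero_left]
  | step i j β ih =>
    rw [wordProd_prepend, mul_apply_eq_comp, ← adjoint_inner_right]
    obtain hγ | ⟨j', γ, rfl⟩ := apply_eq_one_or_exists_eq_prepend i γ
    · rw [adjoint_wordProd_of_apply_eq_one hV hγ j hl', inner_zero_right]
    · rw [adjoint_wordProd_prepend hV hr]
      split_ifs with hj
      · subst hj
        exact ih (ne_of_apply_ne _ h)
      · exact inner_zero_right _

/-- The span of the images of the wandering subspace under all words in the entries of `V`: the
smallest subspace that contains the wandering subspace and is invariant under `V`. -/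
def wanderingSpan (hV : DoublyCommuting n K V) : Submodule ℂ K :=
  ⨆ β, (wanderingSubspace V).map (wordProd hV.commute β : K →ₗ[ℂ] K)

theorem wordProd_mem_wanderingSpan (hV : DoublyCommuting n K V) (β : Words n) {l : K}
    (hl : l ∈ wanderingSubspace V) : wordProd hV.commute β l ∈ wanderingSpan hV :=
  Submodule.mem_iSup_of_mem β ⟨l, hl, rfl⟩

theorem wanderingSubspace_le_wanderingSpan (hV : DoublyCommuting n K V) :
    wanderingSubspace V ≤ wanderingSpan hV :=
  fun l hl => by simpa using wordProd_mem_wanderingSpan hV 1 hl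

theorem isReducing_wanderingSpan (hV : DoublyCommuting n K V) (hr : IsRowIsometric V) (i : Fin k)
    (j : Fin (n i)) : IsReducing (V i j) (wanderingSpan hV) := by
  constructor <;> refine iSup_le fun β => Submodule.map_le_iff_le_comap.2 fun l hl => ?_
  · have hmem := wordProd_mem_wanderingSpan hV (prepend i j β) hl
    rwa [wordProd_prepend] at hmem
  · change adjoint (V i j) (wordProd hV.commute β l) ∈ wanderingSpan hV
    obtain hβ | ⟨j', γ, rfl⟩ := apply_eq_one_or_exists_eq_prepend i β
    · rw [adjoint_wordProd_of_apply_eq_one hV hβ j hl]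
      exact Submodule.zero_mem _
    · rw [adjoint_wordProd_prepend hV hr]
      split_ifs
      · exact wordProd_mem_wanderingSpan hV γ hl
      · exact Submodule.zero_mem _

theorem topologicalClosure_wanderingSpan (hV : DoublyCommuting n K V) (hr : IsRowIsometric V)
    (hp : IsPure V) : (wanderingSpan hV).topologicalClosure = ⊤ := by
  refine Submodule.topologicalClosure_eq_top_iff.2 (eq_bot_of_inf_wanderingSubspace_eq_bot hV hr hp
    (fun i j => (isReducing_wanderingSpan hV hr i j).orthogonal) ?_)
  exact ((Submodule.orthogonal_disjoint _).symm.mono_right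
    (wanderingSubspace_le_wanderingSpan hV)).eq_bot

/-- The embedding `l ↦ V_β l` of the wandering subspace. -/
def wordEmbedding (hV : DoublyCommuting n K V) (hr : IsRowIsometric V) (β : Words n) :
    wanderingSubspace V →ₗᵢ[ℂ] K where
  toLinearMap := (wordProd hV.commute β : K →ₗ[ℂ] K) ∘ₗ (wanderingSubspace V).subtype
  norm_map' x := norm_wordProd hV hr β x

theorem isShiftModel_wordEmbedding (hV : DoublyCommuting n K V) (hr : IsRowIsometric V)
    (hp : IsPure V) : IsShiftModel V (wordEmbedding hV hr) where
  orthogonal _ _ h l l' := inner_wordProd_of_ne hV hr h l.2 l'.2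
  dense := by
    rw [← topologicalClosure_wanderingSpan hV hr hp]
    simp only [wordEmbedding, wanderingSpan, LinearMap.range_comp, Submodule.range_subtype]
  shift i j β l := DFunLike.congr_fun (wordProd_prepend hV.commute i j β).symm (l : K)

end Wold

section Ampliation

variable {E : Type*} [NormedAddCommGroup E] [InnerProductSpace ℂ E]
variable {L : Type*} [NormedAddCommGroup L] [InnerProductSpace ℂ L]

theorem eq_top_of_forall_tmul_mem {N : Submodule ℂ (HTensor E L)}
    (hN : IsClosed (N : Set (HTensor E L)))
    (h : ∀ (e : E) (l : L), ((e ⊗ₜ[ℂ] l : E ⊗[ℂ] L) : HTensor E L) ∈ N) : N = ⊤ := by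
  refine Submodule.eq_top_iff'.2 fun x => ?_
  induction x using UniformSpace.Completion.induction_on with
  | hp => exact hN
  | ih t =>
    induction t using TensorProduct.induction_on with
    | zero => exact N.zero_mem
    | tmul e l => exact h e l
    | add s t hs ht =>
      rw [UniformSpace.Completion.coe_add]
      exact N.add_mem hs ht

/-- The embedding `l ↦ e ⊗ l` for a unit vector `e`. -/
def tmulIsometry (L : Type*) [NormedAddCommGroup L] [InnerProductSpace ℂ L] {e : E}
    (he : ‖e‖ = 1) : L →ₗᵢ[ℂ] HTensor E L where
  toLinearMap := (UniformSpace.Completion.toComplL ∘L TensorProduct.mkL ℂ E L e : L →L[ℂ] _)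
  norm_map' l := (UniformSpace.Completion.norm_coe (e ⊗ₜ[ℂ] l)).trans <| by
    rw [TensorProduct.norm_tmul, he, one_mul]

theorem tmulIsometry_apply {e : E} (he : ‖e‖ = 1) (l : L) :
    tmulIsometry L he l = ((e ⊗ₜ[ℂ] l : E ⊗[ℂ] L) : HTensor E L) := rfl

theorem topologicalClosure_iSup_range_tmulIsometry {ι : Type*} (b : HilbertBasis ι ℂ E) :
    (⨆ i, LinearMap.range
      (tmulIsometry L (b.orthonormal.norm_eq_one i)).toLinearMap).topologicalClosure = ⊤ := by
  set N := ⨆ i, LinearMap.range (tmulIsometry L (b.orthonormal.norm_eq_one i)).toLinearMap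
  have hN : IsClosed (N.topologicalClosure : Set (HTensor E L)) := N.isClosed_topologicalClosure
  refine eq_top_of_forall_tmul_mem hN fun e l => ?_
  let A : E →L[ℂ] HTensor E L :=
    UniformSpace.Completion.toComplL ∘L (TensorProduct.mkL ℂ E L).flip l
  have hle : (Submodule.span ℂ (Set.range b)).topologicalClosure ≤
      N.topologicalClosure.comap (A : E →ₗ[ℂ] HTensor E L) := by
    refine Submodule.topologicalClosure_minimal _ ?_ (hN.preimage A.continuous)
    rw [Submodule.span_le]
    rintro _ ⟨i, rfl⟩
    exact N.le_topologicalClosure (Submodule.mem_iSup_of_mem i ⟨l, rfl⟩)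
  rw [b.dense_span] at hle
  exact hle (Submodule.mem_top (x := e))

variable {k : ℕ} {n : Fin k → ℕ}

theorem isShiftModel_amplTuple {W : ∀ i, Fin (n i) → E →L[ℂ] E} (b : HilbertBasis (Words n) ℂ E)
    (hW : ∀ i j β, W i j (b β) = b (prepend i j β)) :
    IsShiftModel (amplTuple W L) fun β => tmulIsometry L (b.orthonormal.norm_eq_one β) where
  orthogonal β γ h l l' := by
    rw [tmulIsometry_apply, tmulIsometry_apply, UniformSpace.Completion.inner_coe,
      TensorProduct.inner_tmul, b.orthonormal.inner_eq_zero h, zero_mul]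
  dense := topologicalClosure_iSup_range_tmulIsometry b
  shift i j β l := by
    rw [amplTuple, tmulIsometry_apply, ampl_tmul, hW, tmulIsometry_apply]

end Ampliation

section Beurling

universe v w

variable {k : ℕ} {n : Fin k → ℕ}

theorem doublyCommuting_iff_exists_unitarilyEquivalent_amplTuple
    {E : Type*} [NormedAddCommGroup E] [InnerProductSpace ℂ E]
    {W : ∀ i, Fin (n i) → E →L[ℂ] E} (b : HilbertBasis (Words n) ℂ E)
    (hW : ∀ i j β, W i j (b β) = b (prepend i j β))
    {K : Type v} [NormedAddCommGroup K] [InnerProductSpace ℂ K] [CompleteSpace K]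
    {V : ∀ i, Fin (n i) → K →L[ℂ] K} (hr : IsRowIsometric V) (hp : IsPure V) :
    DoublyCommuting n K V ↔
      ∃ (L : Type v) (_ : NormedAddCommGroup L) (_ : InnerProductSpace ℂ L)
        (_ : CompleteSpace L), UnitarilyEquivalent (amplTuple W L) V := by
  constructor
  · intro hV
    have : CompleteSpace (wanderingSubspace V) := isClosed_wanderingSubspace.completeSpace_coe
    exact ⟨wanderingSubspace V, inferInstance, inferInstance, this,
      (isShiftModel_amplTuple b hW).unitarilyEquivalent (isShiftModel_wordEmbedding hV hr hp)⟩
  · rintro ⟨L, _, _, _, hL⟩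
    exact (isShiftModel_amplTuple b hW).doublyCommuting.of_unitarilyEquivalent hL

theorem exists_isometry_range_eq_iff_unitarilyEquivalent
    {K K' : Type*} [NormedAddCommGroup K] [InnerProductSpace ℂ K]
    [NormedAddCommGroup K'] [InnerProductSpace ℂ K']
    {T : ∀ i, Fin (n i) → K →L[ℂ] K} {T' : ∀ i, Fin (n i) → K' →L[ℂ] K'}
    {M : Submodule ℂ K'} (hM : IsJointlyInvariant T' M) :
    (∃ Φ : K →L[ℂ] K',
        Isometry Φ ∧ (∀ i j, Φ ∘L T i j = T' i j ∘L Φ) ∧ (M : Set K') = Set.range Φ) ↔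
      UnitarilyEquivalent T (restrictTuple T' M hM) := by
  constructor
  · rintro ⟨Φ, hΦ, hT, hrange⟩
    let Ψ : K →ₗᵢ[ℂ] K' := ⟨Φ, (AddMonoidHomClass.isometry_iff_norm Φ).1 hΦ⟩
    obtain rfl : M = LinearMap.range Ψ.toLinearMap := SetLike.coe_injective hrange
    exact ⟨Ψ.equivRange, fun i j x => Subtype.ext (DFunLike.congr_fun (hT i j) x)⟩
  · rintro ⟨U, hU⟩
    refine ⟨M.subtypeL ∘L (U : K →L[ℂ] M), isometry_subtype_coe.comp U.isometry,
      fun i j => ContinuousLinearMap.ext fun x => congrArg Subtype.val (hU i j x), ?_⟩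
    exact (Subtype.range_coe.symm.trans (U.surjective.range_comp Subtype.val).symm)

theorem mainTheorem7_general
    {E : Type w} [NormedAddCommGroup E] [InnerProductSpace ℂ E]
    {W : ∀ i, Fin (n i) → E →L[ℂ] E} (b : HilbertBasis (Words n) ℂ E)
    (hW : ∀ i j β, W i j (b β) = b (prepend i j β))
    {H : Type v} [NormedAddCommGroup H] [InnerProductSpace ℂ H]
    (M : ClosedSubmodule ℂ (HTensor E H))
    (hM : IsJointlyInvariant (amplTuple W H) M.toSubmodule) :
    DoublyCommuting n M.toSubmodule (restrictTuple (amplTuple W H) M.toSubmodule hM) ↔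
      ∃ (L : Type (max w v)) (_ : NormedAddCommGroup L) (_ : InnerProductSpace ℂ L)
        (_ : CompleteSpace L) (Φ : HTensor E L →L[ℂ] HTensor E H),
        Isometry Φ ∧ IsMultiAnalytic W Φ ∧ (M : Set _) = Set.range Φ := by
  have hH := isShiftModel_amplTuple (L := H) b hW
  rw [doublyCommuting_iff_exists_unitarilyEquivalent_amplTuple b hW
    (hH.isRowIsometric.restrict hM) (hH.isPure.restrict hM)]
  simp only [← exists_isometry_range_eq_iff_unitarilyEquivalent hM]
  rfl

end Beurling

section Models

/-- The Hilbert basis indexed by `ι'` that arises from `b` by renaming the indices. -/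
def reindexHilbertBasis {ι ι' 𝕜 E : Type*} [RCLike 𝕜] [NormedAddCommGroup E]
    [InnerProductSpace 𝕜 E] [CompleteSpace E] (b : HilbertBasis ι 𝕜 E) (e : ι ≃ ι') :
    HilbertBasis ι' 𝕜 E :=
  HilbertBasis.mk (b.orthonormal.comp e.symm e.symm.injective) <| by
    rw [e.symm.surjective.range_comp, b.dense_span]

theorem reindexHilbertBasis_apply {ι ι' 𝕜 E : Type*} [RCLike 𝕜] [NormedAddCommGroup E]
    [InnerProductSpace 𝕜 E] [CompleteSpace E] (b : HilbertBasis ι 𝕜 E) (e : ι ≃ ι') (i : ι') :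
    reindexHilbertBasis b e i = b (e.symm i) :=
  congrFun (HilbertBasis.coe_mk ..) i

variable {k : ℕ}

/-- The orthonormal basis of the vectors `e^1_{β_1} ⊗ ⋯ ⊗ e^k_{β_k}`. -/
def fockBasis (n : Fin k → ℕ) : HilbertBasis (Words n) ℂ (PolyFock n) :=
  .ofRepr (.refl ℂ _)

theorem coe_fockBasis (n : Fin k → ℕ) : ⇑(fockBasis n) = basisVec :=
  funext fun β => ((fockBasis n).repr_symm_single β).symm

/-- The orthonormal basis of the monomials `z^α` of `H²(𝔻^k)`. -/
def HardySpace.monomialBasis : HilbertBasis (Fin k → ℕ) ℂ (HardySpace k) :=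
  .ofRepr ⟨coeffEquiv, norm_coeffEquiv⟩

theorem HardySpace.monomialBasis_apply (α : Fin k → ℕ) (z : Polydisc k) :
    monomialBasis α z = monomial z.1 α := by
  have hcoeff : coeffEquiv (monomialBasis α : HardySpace k) = lp.single 2 α 1 :=
    monomialBasis.repr_self α
  have hsum := hasSum_coeff (monomialBasis α) z
  rw [hcoeff] at hsum
  refine hsum.unique ?_
  convert hasSum_single α fun γ hγ => ?_
  · simp
  · simp [hγ]

theorem HardySpace.mulCoord_monomialBasis (i : Fin k) (α : Fin k → ℕ) :
    mulCoord i (monomialBasis α) = monomialBasis (raise i α) :=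
  Subtype.ext <| funext fun z => by
    rw [mulCoord_apply, monomialBasis_apply, monomialBasis_apply, monomial_raise]

/-- A tuple of words in one letter each is determined by the tuple of the lengths of the words. -/
def wordExponentEquiv : Words (fun _ : Fin k => 1) ≃ (Fin k → ℕ) :=
  Equiv.piCongrRight fun _ => FreeMonoid.toList.trans (Equiv.listUniqueEquiv (Fin 1))

theorem wordExponentEquiv_prepend (i : Fin k) (j : Fin 1) (β : Words fun _ : Fin k => 1) :
    wordExponentEquiv (prepend i j β) = HardySpace.raise i (wordExponentEquiv β) := by
  funext l
  obtain rfl | h := eq_or_ne l i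
  · simp [wordExponentEquiv, HardySpace.raise, prepend_apply_self]
  · simp [wordExponentEquiv, HardySpace.raise, prepend_apply_of_ne h, h]

/-- The monomials of `H²(𝔻^k)`, indexed by tuples of words in one letter each as for the Fock space
with `n_1 = ⋯ = n_k = 1`. -/
def hardyWordBasis (k : ℕ) : HilbertBasis (Words fun _ : Fin k => 1) ℂ (HardySpace k) :=
  reindexHilbertBasis HardySpace.monomialBasis wordExponentEquiv.symm

theorem coordTuple_hardyWordBasis (i : Fin k) (j : Fin 1) (β : Words fun _ : Fin k => 1) :
    coordTuple k i j (hardyWordBasis k β) = hardyWordBasis k (prepend i j β) := by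
  simp only [hardyWordBasis, reindexHilbertBasis_apply, Equiv.symm_symm, coordTuple,
    HardySpace.mulCoord_monomialBasis, wordExponentEquiv_prepend]

theorem universalModel_fockBasis (n : Fin k → ℕ) (i : Fin k) (j : Fin (n i)) (β : Words n) :
    universalModel n i j (fockBasis n β) = fockBasis n (prepend i j β) := by
  simp only [coe_fockBasis, universalModel_basisVec]

end Models

end Polyball

end

theorem mainTheorem7 {k : ℕ} (hk : 1 ≤ k)
    (H : Type u) [NormedAddCommGroup H] [InnerProductSpace ℂ H] [CompleteSpace H] :
    (∀ n : Fin k → ℕ, (∀ i, 1 ≤ n i) →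
      ∀ (M : ClosedSubmodule ℂ (HTensor (PolyFock n) H))
        (hM : IsJointlyInvariant (amplTuple (universalModel n) H) M.toSubmodule), M ≠ ⊥ →
        (DoublyCommuting n M.toSubmodule
            (restrictTuple (amplTuple (universalModel n) H) M.toSubmodule hM) ↔
          ∃ (L : Type u) (_ : NormedAddCommGroup L) (_ : InnerProductSpace ℂ L)
            (_ : CompleteSpace L) (Φ : HTensor (PolyFock n) L →L[ℂ] HTensor (PolyFock n) H),
            Isometry Φ ∧ IsMultiAnalytic (universalModel n) Φ ∧ (M : Set _) = Set.range Φ)) ∧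
    (∀ (M : ClosedSubmodule ℂ (HTensor (HardySpace k) H))
        (hM : IsJointlyInvariant (n := fun _ => 1) (amplTuple (coordTuple k) H) M.toSubmodule), M ≠ ⊥ →
        (DoublyCommuting (fun _ => 1) M.toSubmodule
            (restrictTuple (amplTuple (coordTuple k) H) M.toSubmodule hM) ↔
          ∃ (L : Type u) (_ : NormedAddCommGroup L) (_ : InnerProductSpace ℂ L)
            (_ : CompleteSpace L) (Φ : HTensor (HardySpace k) L →L[ℂ] HTensor (HardySpace k) H),
            Isometry Φ ∧ IsMultiAnalytic (n := fun _ => 1) (coordTuple k) Φ ∧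
              (M : Set _) = Set.range Φ)) :=
  ⟨fun n _ M hM _ => mainTheorem7_general (fockBasis n) (universalModel_fockBasis n) M hM,
    fun M hM _ => mainTheorem7_general (hardyWordBasis k) coordTuple_hardyWordBasis M hM⟩
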